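/- Let $n \in \mathbf{N}$ and let $\varphi(x,y)$ be a holomorphic quadratic form on $\mathbf{C}^n_x \times \mathbf{C}^n_y$ such that $\det \varphi''_{xy} \neq 0$ and $\operatorname{Im} \varphi''_{yy}$ is positive definite. For $x \in \mathbf{C}^n$ put $$\Phi(x) = \sup_{y \in \mathbf{R}^n} \bigl(-\operatorname{Im} \varphi(x,y)\bigr),$$ which is finite. For $0 < h \leq 1$ let $$H_\Phi(\mathbf{C}^n) = L^2(\mathbf{C}^n, e^{-2\Phi/h}\, L(dx)) \cap \operatorname{Hol}(\mathbf{C}^n),$$ where $L(dx)$ is Lebesgue measure on $\mathbf{C}^n$ and $\operatorname{Hol}(\mathbf{C}^n)$ is the space of entire functions, with the norm and inner product of $L^2(\mathbf{C}^n, e^{-2\Phi/h} L(dx))$. Then there is a constant $C > 0$, depending only on $\varphi$ (and not on $h$), such that for every $0 < h \leq 1$ the metaplectic FBI transform $$Tu(x) = C h^{-3n/4} \int_{\mathbf{R}^n} e^{i\varphi(x,y)/h} u(y)\, dy, \qquad x \in \mathbf{C}^n,$$ is given by an absolutely convergent integral and is an entire function of $x$ for every $u \in L^2(\mathbf{R}^n)$,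 and $T$ is a unitary map (a surjective linear isometry) from $L^2(\mathbf{R}^n)$ onto $H_\Phi(\mathbf{C}^n)$. -/

import Mathlib

open MeasureTheory

namespace MetaplecticFBI

/-- A holomorphic quadratic form `φ(x, y)` on `ℂⁿ × ℂⁿ`. -/
abbrev QuadPhase (n : ℕ) : Type :=
  QuadraticForm ℂ ((Fin n → ℂ) × (Fin n → ℂ))

/-- The inclusion of `ℝⁿ` in `ℂⁿ`. -/
def toComplex {n : ℕ} (y : Fin n → ℝ) : Fin n → ℂ := fun j => (y j : ℂ)

/-- The second derivative of a quadratic form in the directions `v`, `w` is its polar form: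
`∂ₛ ∂ₜ φ(s v + t w) = φ(v + w) - φ(v) - φ(w)`. -/
theorem deriv_deriv_eq_polar {n : ℕ} (φ : QuadPhase n)
    (v w : (Fin n → ℂ) × (Fin n → ℂ)) :
    deriv (fun s : ℂ => deriv (fun t : ℂ => φ (s • v + t • w)) 0) 0 =
      QuadraticMap.polar φ v w := by
  have h1 : ∀ s t : ℂ, φ (s • v + t • w) =
      s * s * φ v + t * t * φ w + s * t * QuadraticMap.polar φ v w := by
    intro s t
    rw [QuadraticMap.map_add φ, QuadraticMap.map_smul, QuadraticMap.map_smul,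
      QuadraticMap.polar_smul_left, QuadraticMap.polar_smul_right]
    simp only [smul_eq_mul]
    ring
  have h2 : ∀ s : ℂ, deriv (fun t : ℂ => φ (s • v + t • w)) 0 =
      s * QuadraticMap.polar φ v w := by
    intro s
    simp only [h1]
    have h3 : HasDerivAt (fun t : ℂ => s * s * φ v + t * t * φ w +
        s * t * QuadraticMap.polar φ v w) (s * QuadraticMap.polar φ v w) 0 := by
      have ht := hasDerivAt_id (0 : ℂ)
      have := (((ht.mul ht).mul_const (φ w)).const_add (s * s * φ v)).add
        ((ht.const_mul s).mul_const (QuadraticMap.polar φ v w))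
      exact this.congr_deriv (by simp)
    exact h3.deriv
  simp only [h2]
  simp

/-- The matrix `φ''_{xy} = (∂²φ / ∂x_j ∂y_k)_{j,k}` of mixed second derivatives. -/
def hessXY {n : ℕ} (φ : QuadPhase n) : Matrix (Fin n) (Fin n) ℂ :=
  Matrix.of fun j k =>
    QuadraticMap.polar φ (Pi.single j 1, 0) (0, Pi.single k 1)

/-- The matrix `φ''_{yy} = (∂²φ / ∂y_j ∂y_k)_{j,k}`. -/
def hessYY {n : ℕ} (φ : QuadPhase n) : Matrix (Fin n) (Fin n) ℂ :=
  Matrix.of fun j k =>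
    QuadraticMap.polar φ (0, Pi.single j 1) (0, Pi.single k 1)

/-- The kernel `e^{i φ(x, y) / h}`, for `x ∈ ℂⁿ` and `y ∈ ℝⁿ`. -/
noncomputable def kernel {n : ℕ} (φ : QuadPhase n) (h : ℝ)
    (x : Fin n → ℂ) (y : Fin n → ℝ) : ℂ :=
  Complex.exp (Complex.I * φ (x, toComplex y) / (h : ℂ))

/-- The metaplectic FBI transform
`Tu(x) = C h^{-3n/4} ∫_{ℝⁿ} e^{i φ(x, y) / h} u(y) dy`, for `x ∈ ℂⁿ`. -/
noncomputable def fbi {n : ℕ} (φ : QuadPhase n) (C h : ℝ)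
    (u : (Fin n → ℝ) → ℂ) (x : Fin n → ℂ) : ℂ :=
  ((C * h ^ (-(3 * (n : ℝ) / 4)) : ℝ) : ℂ) * ∫ y : Fin n → ℝ, kernel φ h x y * u y

/-- The weight `Φ(x) = sup_{y ∈ ℝⁿ} (-Im φ(x, y))`. -/
noncomputable def weight {n : ℕ} (φ : QuadPhase n) (x : Fin n → ℂ) : ℝ :=
  ⨆ y : Fin n → ℝ, -(φ (x, toComplex y)).im

/-- The measure `e^{-2Φ(x)/h} L(dx)` on `ℂⁿ`, where `L` is Lebesgue measure. -/
noncomputable def weightedMeasure {n : ℕ} (Φ : (Fin n → ℂ) → ℝ) (h : ℝ) :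
    Measure (Fin n → ℂ) :=
  (volume : Measure (Fin n → ℂ)).withDensity
    fun x => ENNReal.ofReal (Real.exp (-2 * Φ x / h))

/-- The space `H_Φ(ℂⁿ) = L²(ℂⁿ, e^{-2Φ/h} L(dx)) ∩ Hol(ℂⁿ)`: the subspace of those elements
of the weighted `L²` space that are represented by an entire function, with the norm and the
inner product of the weighted `L²` space. -/
noncomputable def HPhi {n : ℕ} (Φ : (Fin n → ℂ) → ℝ) (h : ℝ) :
    Submodule ℂ (Lp ℂ 2 (weightedMeasure Φ h)) where
  carrier := {f | ∃ g : (Fin n → ℂ) → ℂ,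
    Differentiable ℂ g ∧ (f : (Fin n → ℂ) → ℂ) =ᵐ[weightedMeasure Φ h] g}
  zero_mem' := ⟨fun _ => 0, differentiable_const 0, Lp.coeFn_zero ℂ 2 _⟩
  add_mem' := by
    rintro a b ⟨f, hf, haf⟩ ⟨g, hg, hbg⟩
    exact ⟨f + g, hf.add hg, (Lp.coeFn_add a b).trans (haf.add hbg)⟩
  smul_mem' := by
    rintro c a ⟨f, hf, haf⟩
    exact ⟨c • f, hf.const_smul c, (Lp.coeFn_smul c a).trans (haf.const_smul c)⟩

end MetaplecticFBI

/-!
# Unitarity of the metaplectic FBI transform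

Write `Im φ''_{yy} = Sᵀ S`. With `t = S y` and `w = (φ''_{xy} S⁻¹)ᵀ x` the phase becomes
`φ(x, y) = φ(x, 0) + w · t + Re φ(0, y) + (i / 2) |t|²` (`exists_isNormalForm`), so that
`Φ(x) = -Im φ(x, 0) + |Im w|² / 2`, and every integral below is Gaussian.

The proof works with coherent states. Let `k(x, y) = e^{i φ(x, y) / h}` and `K_a = conj k(a, ·)`.
The Gaussian decay puts `K_a` in `L²(ℝⁿ)`, and `Tu(x) = c ⟪K_x, u⟫`. Three facts carry the proof.

* The `K_a` are total in `L²(ℝⁿ)`: if `⟪K_x, u⟫ = 0` whenever `w` is real, then the Fourier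
  transform of an integrable function vanishes, whence `u = 0` (`dense_span_coherentState`).
* `T K_a` is, up to a constant, an explicit Gaussian `B_a(x)`, holomorphic in `x`
  (`integral_kernel_mul_conj`).
* `B_a` reproduces: after `x = a + z`, the product `conj B_a(x) e^{-2Φ(x)/h}` is an entire function
  of `z`, equal to `1` at the origin, times the Gaussian `e^{-|w(z)|²/(2h)}`. The latter is
  invariant under `z ↦ e^{iθ} z`, so for entire `g ∈ L²(e^{-2Φ/h})` the mean value property gives
  `∫ conj B_a g e^{-2Φ/h} = const · g(a)` (`integral_conj_bergmanExp_mul`).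

Scaling shows that the constants contribute `h^{n/2}` (the Gaussian integral over `ℝⁿ`) and `h^n`
(the one over `ℂⁿ`), which the two factors `h^{-3n/4}` cancel; so `C` can be chosen independently of
`h` with `c ⟪T K_a, g⟫ = g(a)` (`exists_isNormalized`). Taking `g = Tu` gives
`⟪T K_a, T u⟫ = ⟪K_a, u⟫`, so `T` is isometric on the span of the `K_a`, and by density and Fatou's
lemma on all of `L²(ℝⁿ)`. If `F ∈ H_Φ` is orthogonal to every `T K_a`, then `F(a) = 0` for all `a`;
applied to `F - T T* F` this gives surjectivity.
-/

namespace MetaplecticFBI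

open Complex Filter Topology
open scoped ComplexConjugate InnerProductSpace

variable {n : ℕ}

/-! ### Normal form of the phase -/

/-- `(L, N)` puts the phase `φ` into normal form: for `y ∈ ℝⁿ`, with `t = L y` and `w = N x`,
`φ(x, y) = φ(x, 0) + ∑ⱼ wⱼ tⱼ + Re φ(0, y) + (i / 2) ∑ⱼ tⱼ²`. -/
def IsNormalForm (φ : QuadPhase n) (L : (Fin n → ℝ) ≃ₗ[ℝ] (Fin n → ℝ))
    (N : (Fin n → ℂ) ≃ₗ[ℂ] (Fin n → ℂ)) : Prop :=
  ∀ x y, φ (x, toComplex y) =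
    φ (x, 0) + ∑ j, N x j * L y j + ((φ (0, toComplex y)).re : ℂ) + I / 2 * ∑ j, (L y j : ℂ) ^ 2

theorem polar_eq_sum (φ : QuadPhase n) (x y : Fin n → ℂ) :
    QuadraticMap.polar φ (x, 0) (0, y) = ∑ j, ∑ k, x j * y k * hessXY φ j k := by
  have hx : ((x, 0) : (Fin n → ℂ) × (Fin n → ℂ)) =
      ∑ j, x j • ((Pi.single j 1, 0) : (Fin n → ℂ) × (Fin n → ℂ)) := by
    ext i <;> simp [Prod.fst_sum, Prod.snd_sum, Finset.sum_apply, Pi.single_apply]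
  have hy : ((0, y) : (Fin n → ℂ) × (Fin n → ℂ)) =
      ∑ j, y j • ((0, Pi.single j 1) : (Fin n → ℂ) × (Fin n → ℂ)) := by
    ext i <;> simp [Prod.fst_sum, Prod.snd_sum, Finset.sum_apply, Pi.single_apply]
  rw [← QuadraticMap.polarBilin_apply_apply, hx, hy]
  simp only [map_sum, LinearMap.sum_apply, map_smul, LinearMap.smul_apply, hessXY,
    Matrix.of_apply, QuadraticMap.polarBilin_apply_apply, smul_eq_mul, mul_assoc]
  rw [Finset.sum_comm]
  refine Finset.sum_congr rfl fun j _ => ?_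
  rw [Finset.mul_sum]
  exact Finset.sum_congr rfl fun k _ => by ring

theorem two_mul_apply_eq_sum (φ : QuadPhase n) (y : Fin n → ℂ) :
    2 * φ (0, y) = ∑ j, ∑ k, y j * y k * hessYY φ j k := by
  have hy : ((0, y) : (Fin n → ℂ) × (Fin n → ℂ)) =
      ∑ j, y j • ((0, Pi.single j 1) : (Fin n → ℂ) × (Fin n → ℂ)) := by
    ext i <;> simp [Prod.fst_sum, Prod.snd_sum, Finset.sum_apply, Pi.single_apply]
  have h2 : 2 * φ (0, y) = QuadraticMap.polar φ (0, y) (0, y) := by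
    rw [QuadraticMap.polar_self, two_smul, two_mul]
  rw [h2, ← QuadraticMap.polarBilin_apply_apply, hy]
  simp only [map_sum, LinearMap.sum_apply, map_smul, LinearMap.smul_apply, hessYY,
    Matrix.of_apply, QuadraticMap.polarBilin_apply_apply, smul_eq_mul, mul_assoc]
  rw [Finset.sum_comm]
  refine Finset.sum_congr rfl fun j _ => ?_
  rw [Finset.mul_sum]
  exact Finset.sum_congr rfl fun k _ => by ring

theorem apply_eq_add_polar (φ : QuadPhase n) (x y : Fin n → ℂ) :
    φ (x, y) = φ (x, 0) + φ (0, y) + QuadraticMap.polar φ (x, 0) (0, y) := by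
  have := QuadraticMap.map_add φ (x, 0) (0, y)
  simpa using this

open scoped MatrixOrder in
theorem exists_isNormalForm (φ : QuadPhase n) (hxy : (hessXY φ).det ≠ 0)
    (hyy : ((hessYY φ).map Complex.im).PosDef) : ∃ L N, IsNormalForm φ L N := by
  -- Factor `Im φ''_{yy} = Sᵀ S`, so that `L = S` and `N = (φ''_{xy} S⁻¹)ᵀ`.
  obtain ⟨S, hS, hM⟩ := CStarAlgebra.isStrictlyPositive_iff_eq_star_mul_self.mp
    hyy.isStrictlyPositive
  have hSdet : IsUnit S.det := (Matrix.isUnit_iff_isUnit_det S).1 hS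
  let R : Matrix (Fin n) (Fin n) ℂ := S⁻¹.map Complex.ofReal
  have hR : IsUnit R.det := by
    have : R.det = ((S⁻¹).det : ℂ) := (RingHom.map_det Complex.ofRealHom S⁻¹).symm
    rw [this, isUnit_iff_ne_zero]
    exact_mod_cast (Matrix.isUnit_nonsing_inv_det S hSdet).ne_zero
  have hBR : IsUnit (hessXY φ * R).transpose.det := by
    rw [Matrix.det_transpose, Matrix.det_mul]
    exact (isUnit_iff_ne_zero.2 hxy).mul hR
  refine ⟨S.toLinearEquiv' (Matrix.invertibleOfIsUnitDet S hSdet),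
    Matrix.toLinearEquiv' _ (Matrix.invertibleOfIsUnitDet _ hBR), fun x y => ?_⟩
  have hL : ∀ j, S.toLinearEquiv' (Matrix.invertibleOfIsUnitDet S hSdet) y j = (S.mulVec y) j :=
    fun _ => rfl
  have hN : ∀ j, Matrix.toLinearEquiv' _ (Matrix.invertibleOfIsUnitDet _ hBR) x j =
      (Matrix.vecMul x (hessXY φ * R)) j := fun j => by
    rw [← Matrix.mulVec_transpose]; rfl
  have hcast : (fun j => ((S.mulVec y) j : ℂ)) = (S.map Complex.ofReal).mulVec (toComplex y) := by
    ext j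
    exact (Complex.ofRealHom.map_mulVec S y j)
  have hRS : R * S.map Complex.ofReal = 1 := by
    have := congrArg (fun A : Matrix (Fin n) (Fin n) ℝ => A.map Complex.ofRealHom)
      (Matrix.nonsing_inv_mul S hSdet)
    rw [Matrix.map_mul, Matrix.map_one _ (map_zero _) (map_one _)] at this
    exact this
  have hcross : ∑ j, (Matrix.vecMul x (hessXY φ * R)) j * ((S.mulVec y) j : ℂ) =
      QuadraticMap.polar φ (x, 0) (0, toComplex y) := by
    have h1 : ∑ j, (Matrix.vecMul x (hessXY φ * R)) j * ((S.mulVec y) j : ℂ) =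
        Matrix.vecMul x (hessXY φ * R) ⬝ᵥ (fun j => ((S.mulVec y) j : ℂ)) := rfl
    rw [h1, hcast, Matrix.dotProduct_mulVec, Matrix.vecMul_vecMul, Matrix.mul_assoc, hRS,
      Matrix.mul_one, ← Matrix.dotProduct_mulVec, polar_eq_sum]
    simp only [dotProduct, Matrix.mulVec, Finset.mul_sum]
    exact Finset.sum_congr rfl fun j _ => Finset.sum_congr rfl fun k _ => by ring
  have him : 2 * (φ (0, toComplex y)).im = ∑ j, (S.mulVec y) j ^ 2 := by
    have h1 : 2 * (φ (0, toComplex y)).im = (2 * φ (0, toComplex y)).im := by simp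
    have h2 : ∑ j, (S.mulVec y) j ^ 2 = S.mulVec y ⬝ᵥ S.mulVec y := by
      simp [dotProduct, sq]
    have h3 : S.mulVec y ⬝ᵥ S.mulVec y = y ⬝ᵥ ((hessYY φ).map Complex.im).mulVec y := by
      rw [hM, Matrix.star_eq_conjTranspose, ← Matrix.mulVec_mulVec,
        Matrix.conjTranspose_eq_transpose_of_trivial, Matrix.dotProduct_mulVec y,
        Matrix.vecMul_transpose]
    rw [h1, two_mul_apply_eq_sum, h2, h3]
    simp only [dotProduct, Matrix.mulVec, Finset.mul_sum, Complex.im_sum, toComplex,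
      Matrix.map_apply]
    refine Finset.sum_congr rfl fun j _ => Finset.sum_congr rfl fun k _ => ?_
    rw [← Complex.ofReal_mul, Complex.im_ofReal_mul]
    ring
  simp only [hL, hN]
  rw [hcross, apply_eq_add_polar]
  have h4 : ∑ j, ((S.mulVec y j : ℝ) : ℂ) ^ 2 = ((2 * (φ (0, toComplex y)).im : ℝ) : ℂ) := by
    rw [him]; push_cast; rfl
  rw [h4]
  have h5 := Complex.re_add_im (φ (0, toComplex y))
  push_cast
  linear_combination -h5

/-! ### Linear changes of variables -/

section ChangeOfVariables

variable {E : Type*} [NormedAddCommGroup E] [NormedSpace ℝ E] [FiniteDimensional ℝ E]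
  [MeasureSpace E] [BorelSpace E] [(volume : Measure E).IsAddHaarMeasure]

theorem integrable_comp_linearEquiv (L : E ≃ₗ[ℝ] E) {f : E → ℂ} (hf : Integrable f) :
    Integrable fun y => f (L y) := by
  have hm : Measurable L := (L.toContinuousLinearEquiv.continuous).measurable
  have h := Measure.map_linearMap_addHaar_eq_smul_addHaar (volume : Measure E)
    (f := (L : E →ₗ[ℝ] E)) L.isUnit_det'.ne_zero
  refine Integrable.comp_measurable ?_ hm
  have h' : Measure.map L (volume : Measure E) = _ := h
  rw [h']
  exact hf.smul_measure ENNReal.ofReal_ne_top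

theorem integral_comp_linearEquiv (L : E ≃ₗ[ℝ] E) (f : E → ℂ) :
    ∫ y, f (L y) = (|(LinearMap.det (L : E →ₗ[ℝ] E))⁻¹| : ℝ) * ∫ t, f t := by
  have hm : MeasurableEmbedding L :=
    L.toContinuousLinearEquiv.toHomeomorph.measurableEmbedding
  have h := Measure.map_linearMap_addHaar_eq_smul_addHaar (volume : Measure E)
    (f := (L : E →ₗ[ℝ] E)) L.isUnit_det'.ne_zero
  have h' : Measure.map L (volume : Measure E) = _ := h
  rw [← hm.integral_map, h', integral_smul_measure, ENNReal.toReal_ofReal (abs_nonneg _)]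
  simp

end ChangeOfVariables

/-! ### Rotation averages -/

theorem measurePreserving_rotation (θ : ℝ) :
    MeasurePreserving fun z : Fin n → ℂ => cexp (θ * I) • z := by
  have h := volume_preserving_pi (ι := Fin n) (f := fun _ => rotation (Circle.exp θ))
    fun _ => (rotation (Circle.exp θ)).measurePreserving
  convert h using 2 with z
  ext j
  simp [rotation_apply, Circle.coe_exp]

/-- The mean value property, averaged against a weight that is invariant under the circle
action `z ↦ e^{iθ} z`: only the value of the entire function at the origin survives. -/
theorem integral_entire_mul_of_rotation_invariant {g w : (Fin n → ℂ) → ℂ}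
    (hg : Differentiable ℂ g) (hwc : Continuous w)
    (hw : ∀ (θ : ℝ) z, w (cexp (θ * I) • z) = w z) (hint : Integrable fun z => g z * w z) :
    ∫ z, g z * w z = g 0 * ∫ z, w z := by
  have hemb (θ : ℝ) : MeasurableEmbedding fun z : Fin n → ℂ => cexp (θ * I) • z :=
    (Homeomorph.smulOfNeZero (cexp (θ * I)) (Complex.exp_ne_zero _)).measurableEmbedding
  let H : ℝ → (Fin n → ℂ) → ℂ := fun θ z => g (cexp (θ * I) • z) * w z
  have hH (θ : ℝ) : H θ = fun z => (fun z => g z * w z) (cexp (θ * I) • z) := by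
    ext z; simp only [H, hw]
  have hHc : Continuous (Function.uncurry H) := by
    have := hg.continuous
    simp only [H, Function.uncurry_def]
    fun_prop
  have hHint (θ : ℝ) : Integrable (H θ) := by
    rw [hH]
    exact ((measurePreserving_rotation θ).integrable_comp_emb (hemb θ)).2 hint
  have hHval (θ : ℝ) : ∫ z, H θ z = ∫ z, g z * w z := by
    rw [hH]
    exact (measurePreserving_rotation θ).integral_comp (hemb θ) _
  have hHnorm (θ : ℝ) : ∫ z, ‖H θ z‖ = ∫ z, ‖g z * w z‖ := by
    rw [hH]
    exact (measurePreserving_rotation θ).integral_comp (hemb θ) fun z => ‖g z * w z‖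
  have hprod : Integrable (Function.uncurry H)
      ((volume.restrict (Set.Ioc 0 (2 * Real.pi))).prod volume) := by
    rw [integrable_prod_iff hHc.aestronglyMeasurable]
    refine ⟨Filter.Eventually.of_forall hHint, ?_⟩
    simp only [Function.uncurry_apply_pair, hHnorm]
    exact integrable_const _
  have hmean (z : Fin n → ℂ) :
      ∫ θ in Set.Ioc 0 (2 * Real.pi), H θ z = (2 * Real.pi : ℝ) * (g 0 * w z) := by
    have hd : Differentiable ℂ fun s : ℂ => g (s • z) := by fun_prop
    have h1 := (hd.diffContOnCl (s := Metric.ball 0 |1|)).circleAverage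
    rw [Real.circleAverage_def, intervalIntegral.integral_of_le Real.two_pi_pos.le] at h1
    simp only [circleMap_zero, Complex.ofReal_one, one_mul, zero_smul] at h1
    simp only [H]
    rw [integral_mul_const, ← h1, Complex.real_smul, Complex.ofReal_inv, ← mul_assoc, ← mul_assoc,
      mul_inv_cancel₀ (by exact_mod_cast Real.two_pi_pos.ne'), one_mul]
  have hswap := integral_integral_swap hprod
  simp only [hHval, hmean] at hswap
  rw [integral_const, integral_const_mul, integral_const_mul] at hswap
  have h2pi : ((2 * Real.pi : ℝ) : ℂ) ≠ 0 := by exact_mod_cast Real.two_pi_pos.ne'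
  refine mul_left_cancel₀ h2pi ?_
  rw [← hswap]
  simp [measureReal_def, Real.pi_pos.le]

/-! ### Gaussian computations with the kernel -/

theorem differentiable_quadPhase (φ : QuadPhase n) : Differentiable ℂ φ := by
  let B : ((Fin n → ℂ) × (Fin n → ℂ)) →L[ℂ] ((Fin n → ℂ) × (Fin n → ℂ)) →L[ℂ] ℂ :=
    LinearMap.toContinuousLinearMap
      ((LinearMap.toContinuousLinearMap (𝕜 := ℂ) (E := (Fin n → ℂ) × (Fin n → ℂ))
        (F' := ℂ)).toLinearMap ∘ₗ φ.polarBilin)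
  have h : (φ : (Fin n → ℂ) × (Fin n → ℂ) → ℂ) = fun v => 2⁻¹ * B v v := by
    ext v
    have : B v v = 2 * φ v := by
      change QuadraticMap.polar φ v v = 2 * φ v
      rw [QuadraticMap.polar_self, two_smul, two_mul]
    rw [this]
    ring
  rw [h]
  fun_prop

theorem continuous_toComplex : Continuous (toComplex : (Fin n → ℝ) → Fin n → ℂ) := by
  unfold toComplex
  fun_prop

theorem continuous_kernel (φ : QuadPhase n) (h : ℝ) (x : Fin n → ℂ) :
    Continuous (kernel φ h x) := by
  have h1 := (differentiable_quadPhase φ).continuous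
  have h2 := continuous_toComplex (n := n)
  unfold kernel
  fun_prop

variable {φ : QuadPhase n} {L : (Fin n → ℝ) ≃ₗ[ℝ] (Fin n → ℝ)}
  {N : (Fin n → ℂ) ≃ₗ[ℂ] (Fin n → ℂ)} {h C : ℝ}

theorem neg_im_apply_eq (hLN : IsNormalForm φ L N) (x : Fin n → ℂ) (y : Fin n → ℝ) :
    -(φ (x, toComplex y)).im = -(φ (x, 0)).im + 1 / 2 * ∑ j, (N x j).im ^ 2 -
      1 / 2 * ∑ j, (L y j + (N x j).im) ^ 2 := by
  rw [hLN x y]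
  have h1 : (∑ j, N x j * (L y j : ℂ)).im = ∑ j, (N x j).im * L y j := by
    simp [Complex.im_sum]
  have h2 : (I / 2 * ∑ j, (L y j : ℂ) ^ 2).im = 1 / 2 * ∑ j, L y j ^ 2 := by
    have : (I / 2 * ∑ j, (L y j : ℂ) ^ 2) = ((1 / 2 * ∑ j, L y j ^ 2 : ℝ) : ℂ) * I := by
      push_cast; ring
    rw [this, Complex.im_ofReal_mul, Complex.I_im, mul_one]
  have h3 : ∑ j, (L y j + (N x j).im) ^ 2 =
      ∑ j, L y j ^ 2 + 2 * ∑ j, (N x j).im * L y j + ∑ j, (N x j).im ^ 2 := by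
    rw [Finset.mul_sum, ← Finset.sum_add_distrib, ← Finset.sum_add_distrib]
    exact Finset.sum_congr rfl fun j _ => by ring
  rw [Complex.add_im, Complex.add_im, Complex.add_im, h1, h2, h3, Complex.ofReal_im]
  ring

/-- The supremum defining the weight is attained where `L y = -Im N x`. -/
theorem isGreatest_weight (hLN : IsNormalForm φ L N) (x : Fin n → ℂ) :
    IsGreatest (Set.range fun y : Fin n → ℝ => -(φ (x, toComplex y)).im)
      (-(φ (x, 0)).im + 1 / 2 * ∑ j, (N x j).im ^ 2) := by
  constructor
  · refine ⟨L.symm fun j => -(N x j).im, ?_⟩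
    simp [neg_im_apply_eq hLN]
  · rintro _ ⟨y, rfl⟩
    simp only [neg_im_apply_eq hLN]
    have : 0 ≤ ∑ j, (L y j + (N x j).im) ^ 2 := Finset.sum_nonneg fun j _ => sq_nonneg _
    linarith

theorem weight_eq (hLN : IsNormalForm φ L N) (x : Fin n → ℂ) :
    weight φ x = -(φ (x, 0)).im + 1 / 2 * ∑ j, (N x j).im ^ 2 :=
  (isGreatest_weight hLN x).isLUB.csSup_eq ⟨_, 0, rfl⟩

theorem continuous_linearEquiv_apply (N : (Fin n → ℂ) ≃ₗ[ℂ] (Fin n → ℂ)) (j : Fin n) :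
    Continuous fun x => N x j :=
  (continuous_apply j).comp N.toContinuousLinearEquiv.continuous

theorem continuous_weight (hLN : IsNormalForm φ L N) : Continuous (weight φ) := by
  have h1 := (differentiable_quadPhase φ).continuous
  have h2 := continuous_linearEquiv_apply N
  rw [funext (weight_eq hLN)]
  fun_prop

theorem kernel_eq (hLN : IsNormalForm φ L N) (h : ℝ) (x : Fin n → ℂ) (y : Fin n → ℝ) :
    kernel φ h x y = cexp (I * φ (x, 0) / h) *
      cexp (((φ (0, toComplex y)).re / h : ℝ) * I) *
      cexp (-(1 / (2 * h) : ℝ) * ∑ j, (L y j : ℂ) ^ 2 + ∑ j, I / h * N x j * L y j) := by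
  unfold kernel
  rw [hLN x y, ← Complex.exp_add, ← Complex.exp_add]
  congr 1
  simp only [mul_assoc, ← Finset.mul_sum]
  push_cast
  linear_combination (1 / 2 * (h : ℂ)⁻¹ * ∑ j, (L y j : ℂ) ^ 2) * I_mul_I

theorem integrable_kernel (hLN : IsNormalForm φ L N) (hh : 0 < h) (x : Fin n → ℂ) :
    Integrable (kernel φ h x) := by
  have h1 : (0 : ℝ) < ((1 / (2 * h) : ℝ) : ℂ).re := by
    rw [Complex.ofReal_re]; positivity
  have h2 := integrable_comp_linearEquiv L
    (GaussianFourier.integrable_cexp_neg_mul_sum_add h1 fun j => I / h * N x j)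
  refine (h2.norm.const_mul ‖cexp (I * φ (x, 0) / h)‖).mono'
    (continuous_kernel φ h x).aestronglyMeasurable (Eventually.of_forall fun y => le_of_eq ?_)
  rw [kernel_eq hLN, norm_mul, norm_mul, Complex.norm_exp_ofReal_mul_I, mul_one]

theorem memLp_kernel (hLN : IsNormalForm φ L N) (hh : 0 < h) (x : Fin n → ℂ) :
    MemLp (kernel φ h x) 2 := by
  rw [memLp_two_iff_integrable_sq_norm (continuous_kernel φ h x).aestronglyMeasurable]
  -- The square of the kernel is the kernel with `h / 2` in place of `h`.
  refine (integrable_kernel hLN (half_pos hh) x).norm.congr (Eventually.of_forall fun y => ?_)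
  simp only
  rw [← norm_pow, kernel, kernel, ← Complex.exp_nat_mul]
  congr 2
  push_cast
  field_simp

/-- The constant in the Gaussian integral `∫ k(x, y) conj k(a, y) dy`. -/
noncomputable def gramConst (L : (Fin n → ℝ) ≃ₗ[ℝ] (Fin n → ℝ)) (h : ℝ) : ℝ :=
  |(LinearMap.det (L : (Fin n → ℝ) →ₗ[ℝ] (Fin n → ℝ)))⁻¹| * (Real.pi * h) ^ ((n : ℝ) / 2)

/-- The reproducing kernel of `H_Φ` up to a constant factor. It is holomorphic in `x` and
antiholomorphic in `a`. -/
noncomputable def bergmanExp (φ : QuadPhase n) (N : (Fin n → ℂ) ≃ₗ[ℂ] (Fin n → ℂ)) (h : ℝ)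
    (a x : Fin n → ℂ) : ℂ :=
  cexp ((I * (φ (x, 0) - conj (φ (a, 0))) - 1 / 4 * ∑ j, (N x j - conj (N a j)) ^ 2) / h)

theorem integral_kernel_mul_conj (hLN : IsNormalForm φ L N) (hh : 0 < h) (a x : Fin n → ℂ) :
    ∫ y, kernel φ h x y * conj (kernel φ h a y) = gramConst L h * bergmanExp φ N h a x := by
  have hb : (0 : ℝ) < (((1 / h : ℝ)) : ℂ).re := by
    rw [Complex.ofReal_re]; positivity
  have hh' : (h : ℂ) ≠ 0 := by exact_mod_cast hh.ne'
  have key (y : Fin n → ℝ) : kernel φ h x y * conj (kernel φ h a y) =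
      cexp (I * (φ (x, 0) - conj (φ (a, 0))) / h) *
        cexp (-(1 / h : ℝ) * ∑ j, (L y j : ℂ) ^ 2 +
          ∑ j, I / h * (N x j - conj (N a j)) * L y j) := by
    rw [kernel_eq hLN, kernel_eq hLN]
    simp only [← Complex.exp_conj, ← Complex.exp_add]
    congr 1
    simp only [map_add, map_mul, map_sum, map_div₀, map_neg, map_pow, Complex.conj_ofReal,
      Complex.conj_I, mul_sub, sub_mul, Finset.sum_sub_distrib, mul_assoc, ← Finset.mul_sum]
    push_cast
    field_simp
    ring
  simp only [key]
  rw [integral_const_mul, integral_comp_linearEquiv L fun t : Fin n → ℝ =>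
    cexp (-(1 / h : ℝ) * ∑ j, (t j : ℂ) ^ 2 + ∑ j, I / h * (N x j - conj (N a j)) * t j),
    GaussianFourier.integral_cexp_neg_mul_sum_add hb]
  have hpow : ((Real.pi : ℂ) / (1 / h : ℝ)) ^ (Fintype.card (Fin n) / 2 : ℂ) =
      ((Real.pi * h) ^ ((n : ℝ) / 2) : ℝ) := by
    rw [Complex.ofReal_cpow (by positivity)]
    simp
  rw [hpow, gramConst, bergmanExp, sub_div,
    sub_eq_add_neg (I * (φ (x, 0) - conj (φ (a, 0))) / h), Complex.exp_add]
  have hexp : (∑ j, (I / h * (N x j - conj (N a j))) ^ 2) / (4 * ((1 / h : ℝ) : ℂ)) =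
      -(1 / 4 * ∑ j, (N x j - conj (N a j)) ^ 2 / h) := by
    simp only [mul_pow, ← Finset.mul_sum, ← Finset.sum_div, div_pow, I_sq]
    push_cast
    field_simp
  rw [hexp, ← Finset.sum_div, mul_div_assoc]
  push_cast
  ring_nf

/-- The Gaussian `e^{-|N z|² / (2 h)}` on `ℂⁿ`. -/
noncomputable def gauss (N : (Fin n → ℂ) ≃ₗ[ℂ] (Fin n → ℂ)) (h : ℝ) (z : Fin n → ℂ) : ℝ :=
  Real.exp (-(∑ j, ‖N z j‖ ^ 2) / (2 * h))

theorem continuous_gauss (N : (Fin n → ℂ) ≃ₗ[ℂ] (Fin n → ℂ)) (h : ℝ) :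
    Continuous (gauss N h) := by
  have h2 := continuous_linearEquiv_apply N
  unfold gauss
  fun_prop

theorem integrable_gauss (N : (Fin n → ℂ) ≃ₗ[ℂ] (Fin n → ℂ)) (hh : 0 < h) :
    Integrable (gauss N h) := by
  have h1 : (0 : ℝ) < ((1 / (2 * h) : ℝ) : ℂ).re := by
    rw [Complex.ofReal_re]; positivity
  have h2 : Integrable fun z : Fin n → ℂ => ∏ j, cexp (-(1 / (2 * h) : ℝ) * ‖z j‖ ^ 2) :=
    Integrable.fintype_prod (f := fun (_ : Fin n) (z : ℂ) => cexp (-(1 / (2 * h) : ℝ) * ‖z‖ ^ 2))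
      fun _ => by
        simpa using GaussianFourier.integrable_cexp_neg_mul_sq_norm_add (V := ℂ) h1 0 0
  refine (integrable_comp_linearEquiv (N.restrictScalars ℝ) h2).norm.congr
    (Eventually.of_forall fun z => ?_)
  simp only [LinearEquiv.restrictScalars_apply]
  rw [← Complex.exp_sum, Complex.norm_exp, gauss, ← Finset.mul_sum]
  congr 1
  have : (-((1 / (2 * h) : ℝ) : ℂ) * ∑ j, (‖N z j‖ : ℂ) ^ 2) =
      ((-(∑ j, ‖N z j‖ ^ 2) / (2 * h) : ℝ) : ℂ) := by
    push_cast; ring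
  rw [this, Complex.ofReal_re]

theorem integral_gauss_pos (N : (Fin n → ℂ) ≃ₗ[ℂ] (Fin n → ℂ)) (hh : 0 < h) :
    0 < ∫ z, gauss N h z :=
  integral_exp_pos (integrable_gauss N hh)

theorem integral_gauss_eq (N : (Fin n → ℂ) ≃ₗ[ℂ] (Fin n → ℂ)) (hh : 0 < h) :
    ∫ z, gauss N h z = h ^ n * ∫ z, gauss N 1 z := by
  have h1 (z : Fin n → ℂ) : gauss N h z = gauss N 1 ((√h)⁻¹ • z) := by
    have h2 : N ((√h)⁻¹ • z) = (√h)⁻¹ • N z := (N.restrictScalars ℝ).map_smul _ _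
    simp only [gauss, h2, Pi.smul_apply, norm_smul, mul_pow, norm_inv, Real.norm_eq_abs, inv_pow,
      sq_abs, Real.sq_sqrt hh.le, ← Finset.mul_sum]
    congr 1
    field_simp
  simp only [h1]
  rw [Measure.integral_comp_inv_smul]
  have h3 : Module.finrank ℝ (Fin n → ℂ) = 2 * n := by
    rw [Module.finrank_pi_fintype]; simp [mul_comm]
  rw [h3, pow_mul, Real.sq_sqrt hh.le, abs_of_pos (by positivity), smul_eq_mul]

/-- Relative to the weight, the reproducing kernel centred at `a` is the product of an entire
function of `x - a` and a Gaussian. -/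
theorem conj_bergmanExp_mul_exp_weight (hLN : IsNormalForm φ L N) (hh : 0 < h)
    (a z : Fin n → ℂ) :
    conj (bergmanExp φ N h a (a + z)) * Real.exp (-2 * weight φ (a + z) / h) =
      cexp ((I * (φ (a, 0) - φ (a + z, 0)) +
        1 / 4 * ∑ j, N z j * (2 * N a j + N z j - 2 * conj (N a j))) / h) * gauss N h z := by
  have hh' : (h : ℂ) ≠ 0 := by exact_mod_cast hh.ne'
  rw [bergmanExp, ← Complex.exp_conj, weight_eq hLN, gauss]
  push_cast
  rw [← Complex.exp_add, ← Complex.exp_add]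
  congr 1
  have hterm (j : Fin n) : -(1 / 4) * (conj (N (a + z) j) - N a j) ^ 2 -
      ((N (a + z) j).im : ℂ) ^ 2 =
      1 / 4 * (N z j * (2 * N a j + N z j - 2 * conj (N a j))) - 1 / 2 * (‖N z j‖ : ℂ) ^ 2 := by
    rw [Complex.im_eq_sub_conj, ← Complex.mul_conj', div_pow, mul_pow, I_sq, map_add N,
      Pi.add_apply, map_add]
    ring
  have hsum := Finset.sum_congr rfl fun j (_ : j ∈ Finset.univ) => hterm j
  simp only [Finset.sum_sub_distrib, ← Finset.mul_sum] at hsum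
  have him : ((φ (a + z, 0)).im : ℂ) = (φ (a + z, 0) - conj (φ (a + z, 0))) / (2 * I) :=
    Complex.im_eq_sub_conj _
  have hI : (φ (a + z, 0) - conj (φ (a + z, 0))) / (2 * I) =
      -I / 2 * (φ (a + z, 0) - conj (φ (a + z, 0))) := by
    rw [div_eq_iff (by simp)]
    linear_combination (φ (a + z, 0) - conj (φ (a + z, 0))) * I_sq
  rw [him, hI]
  simp only [map_div₀, map_sub, map_mul, map_sum, map_pow, Complex.conj_ofReal, Complex.conj_I,
    Complex.conj_conj, map_one, map_ofNat]
  field_simp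
  linear_combination 8 * hsum

theorem norm_sq_bergmanExp_mul_exp_weight (hLN : IsNormalForm φ L N) (hh : 0 < h)
    (a x : Fin n → ℂ) :
    ‖bergmanExp φ N h a x‖ ^ 2 * Real.exp (-2 * weight φ x / h) =
      Real.exp (2 * weight φ a / h) * gauss N h (x - a) := by
  rw [bergmanExp, Complex.norm_exp, weight_eq hLN, weight_eq hLN, gauss, ← Real.exp_nat_mul,
    ← Real.exp_add, ← Real.exp_add]
  congr 1
  have hterm (j : Fin n) : -(1 / 2) * ((N x j - conj (N a j)) ^ 2).re - (N x j).im ^ 2 -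
      (N a j).im ^ 2 = -(1 / 2) * ‖N (x - a) j‖ ^ 2 := by
    rw [← Complex.normSq_eq_norm_sq, Complex.normSq_apply, map_sub N, Pi.sub_apply]
    simp only [sq, Complex.mul_re, Complex.sub_re, Complex.sub_im, Complex.conj_re,
      Complex.conj_im]
    ring
  have hsum := Finset.sum_congr rfl fun j (_ : j ∈ Finset.univ) => hterm j
  simp only [Finset.sum_sub_distrib, ← Finset.mul_sum] at hsum
  have hre : (((I * (φ (x, 0) - conj (φ (a, 0))) -
      1 / 4 * ∑ j, (N x j - conj (N a j)) ^ 2) / h).re : ℝ) =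
      (-(φ (x, 0)).im - (φ (a, 0)).im - 1 / 4 * ∑ j, ((N x j - conj (N a j)) ^ 2).re) / h := by
    rw [Complex.div_ofReal_re, Complex.sub_re, ← Complex.re_sum, Complex.I_mul_re, Complex.sub_im,
      Complex.conj_im]
    have : (1 / 4 : ℂ) = ((1 / 4 : ℝ) : ℂ) := by push_cast; rfl
    rw [this, Complex.re_ofReal_mul]
    ring
  rw [hre]
  field_simp
  push_cast
  linear_combination 8 * hsum

/-! ### Injectivity of the Fourier transform -/

/-- An integrable function on `ℝⁿ` whose Fourier transform vanishes is zero almost everywhere: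
by self-adjointness of the Fourier transform it is orthogonal to all test functions. -/
theorem ae_eq_zero_of_fourier_eq_zero {V : Type*} [NormedAddCommGroup V] [InnerProductSpace ℝ V]
    [FiniteDimensional ℝ V] [MeasurableSpace V] [BorelSpace V] {f : V → ℂ} (hf : Integrable f)
    (h : ∀ ξ, FourierTransform.fourier f ξ = 0) : f =ᵐ[volume] 0 := by
  refine ae_eq_zero_of_integral_contDiff_smul_eq_zero hf.locallyIntegrable fun g hg hgc => ?_
  let G : SchwartzMap V ℂ := (hgc.comp_left (g := Complex.ofReal) Complex.ofReal_zero).toSchwartzMap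
    (Complex.ofRealCLM.contDiff.comp hg)
  have hG : FourierTransform.fourier (FourierTransformInv.fourierInv G) = G :=
    FourierTransform.fourier_fourierInv_eq G
  have hflip := VectorFourier.integral_fourierIntegral_smul_eq_flip (L := innerₗ V)
    Real.continuous_fourierChar continuous_inner hf
    ((FourierTransformInv.fourierInv G : SchwartzMap V ℂ).integrable (μ := volume))
  have hflip' : ∫ ξ, FourierTransform.fourier f ξ •
      (FourierTransformInv.fourierInv G : SchwartzMap V ℂ) ξ =
      ∫ x, f x • FourierTransform.fourier
        ((FourierTransformInv.fourierInv G : SchwartzMap V ℂ) : V → ℂ) x := by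
    simpa using! hflip
  rw [← SchwartzMap.fourier_coe, hG] at hflip'
  simp only [h, zero_smul, integral_zero] at hflip'
  rw [hflip']
  refine integral_congr_ae (Eventually.of_forall fun x => ?_)
  have : G x = (g x : ℂ) := rfl
  simp only [this, Complex.real_smul, smul_eq_mul, mul_comm]

theorem ae_eq_zero_of_integral_exp_eq_zero {f : (Fin n → ℝ) → ℂ} (hf : Integrable f)
    (h : ∀ s : Fin n → ℝ, ∫ y, cexp (I * ∑ j, (s j : ℂ) * y j) * f y = 0) : f =ᵐ[volume] 0 := by
  have hmp := PiLp.volume_preserving_ofLp (Fin n)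
  have hemb : MeasurableEmbedding (WithLp.ofLp : EuclideanSpace ℝ (Fin n) → Fin n → ℝ) :=
    (MeasurableEquiv.toLp 2 (Fin n → ℝ)).symm.measurableEmbedding
  have h0 : (fun v : EuclideanSpace ℝ (Fin n) => f v.ofLp) =ᵐ[volume] 0 := by
    refine ae_eq_zero_of_fourier_eq_zero ((hmp.integrable_comp_emb hemb).2 hf) fun ξ => ?_
    rw [← h fun j => -2 * Real.pi * ξ j, ← hmp.integral_comp hemb, Real.fourier_eq']
    refine integral_congr_ae (Eventually.of_forall fun v => ?_)
    simp only [smul_eq_mul, PiLp.inner_apply, RCLike.inner_apply, conj_trivial]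
    congr 2
    push_cast
    rw [Finset.mul_sum, Finset.sum_mul, Finset.mul_sum]
    exact Finset.sum_congr rfl fun j _ => by ring
  rw [← hmp.map_eq]
  exact (hemb.ae_map_iff (p := fun y => f y = 0)).2 h0

/-! ### Holomorphic dependence on parameters -/

/-- Differentiation under the integral sign for an exponential kernel. -/
theorem differentiable_integral_cexp {α E : Type*} [MeasurableSpace α] {μ : Measure α}
    [NormedAddCommGroup E] [NormedSpace ℂ E] {A : α → E →L[ℂ] ℂ} {v : α → ℂ}
    (hA : AEStronglyMeasurable A μ) (hv : AEStronglyMeasurable v μ)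
    (hint : ∀ R : ℝ, Integrable (fun y => Real.exp (R * ‖A y‖) * ‖v y‖) μ) :
    Differentiable ℂ fun w => ∫ y, cexp (A y w) * v y ∂μ := by
  intro w₀
  have hmeas (w : E) : AEStronglyMeasurable (fun y => cexp (A y w) * v y) μ :=
    (Complex.continuous_exp.comp_aestronglyMeasurable (hA.apply_continuousLinearMap w)).mul hv
  have hexp (w : E) (y : α) : ‖cexp (A y w)‖ ≤ Real.exp (‖w‖ * ‖A y‖) := by
    rw [Complex.norm_exp]
    refine Real.exp_le_exp.2 ((Complex.re_le_norm _).trans ?_)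
    rw [mul_comm]
    exact (A y).le_opNorm w
  refine (hasFDerivAt_integral_of_dominated_of_fderiv_le
    (F := fun w y => cexp (A y w) * v y) (F' := fun w y => (cexp (A y w) * v y) • A y)
    (bound := fun y => Real.exp ((‖w₀‖ + 2) * ‖A y‖) * ‖v y‖)
    (Metric.ball_mem_nhds w₀ one_pos) (Eventually.of_forall hmeas) ?_
    ((hmeas w₀).smul hA) (Eventually.of_forall fun y w hw => ?_) (hint _)
    (Eventually.of_forall fun y w _ => ?_)).differentiableAt
  · refine (hint ‖w₀‖).mono' (hmeas w₀) (Eventually.of_forall fun y => ?_)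
    rw [norm_mul]
    gcongr
    exact hexp w₀ y
  · have hw' : ‖w‖ ≤ ‖w₀‖ + 1 := by
      have := norm_sub_norm_le w w₀
      rw [mem_ball_iff_norm] at hw
      linarith
    -- One power of `‖A y‖` is absorbed by an extra factor `exp ‖A y‖`.
    have h1 : ‖A y‖ ≤ Real.exp ‖A y‖ := by linarith [Real.add_one_le_exp ‖A y‖]
    calc ‖(cexp (A y w) * v y) • A y‖ = ‖cexp (A y w)‖ * ‖v y‖ * ‖A y‖ := by
          rw [norm_smul, norm_mul]
      _ ≤ Real.exp ((‖w₀‖ + 1) * ‖A y‖) * ‖v y‖ * Real.exp ‖A y‖ := by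
          gcongr
          exact (hexp w y).trans (by gcongr)
      _ = Real.exp ((‖w₀‖ + 2) * ‖A y‖) * ‖v y‖ := by
          rw [mul_right_comm, ← Real.exp_add]
          ring_nf
  · have := ((A y).hasFDerivAt (x := w)).cexp.mul_const (v y)
    rwa [smul_smul, mul_comm (v y)] at this

theorem integrable_kernel_mul (hLN : IsNormalForm φ L N) (hh : 0 < h) (x : Fin n → ℂ)
    {u : (Fin n → ℝ) → ℂ} (hu : MemLp u 2) : Integrable fun y => kernel φ h x y * u y :=
  (memLp_kernel hLN hh x).integrable_mul hu

theorem kernel_eq_mul_kernel_zero (hLN : IsNormalForm φ L N) (h : ℝ) (x : Fin n → ℂ)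
    (y : Fin n → ℝ) : kernel φ h x y =
      cexp (I * φ (x, 0) / h) * (cexp (∑ j, I / h * N x j * L y j) * kernel φ h 0 y) := by
  have h0 : φ ((0, 0) : (Fin n → ℂ) × (Fin n → ℂ)) = 0 := QuadraticMap.map_zero φ
  rw [kernel_eq hLN, kernel_eq hLN h 0 y, Complex.exp_add, Complex.exp_add, h0]
  simp
  ring

theorem norm_kernel_zero (hLN : IsNormalForm φ L N) (h : ℝ) (y : Fin n → ℝ) :
    ‖kernel φ h 0 y‖ = Real.exp (-(1 / (2 * h)) * ∑ j, L y j ^ 2) := by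
  have h0 : φ ((0, 0) : (Fin n → ℂ) × (Fin n → ℂ)) = 0 := QuadraticMap.map_zero φ
  rw [kernel_eq hLN, norm_mul, norm_mul, Complex.norm_exp_ofReal_mul_I, h0]
  have h1 : (-((1 / (2 * h) : ℝ) : ℂ) * ∑ j, (L y j : ℂ) ^ 2 +
      ∑ j, I / h * N 0 j * (L y j : ℂ)) = ((-(1 / (2 * h)) * ∑ j, L y j ^ 2 : ℝ) : ℂ) := by
    simp
  rw [h1, ← Complex.ofReal_exp, Complex.norm_real, Real.norm_of_nonneg (Real.exp_pos _).le]
  simp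

theorem differentiable_integral_kernel_mul (hLN : IsNormalForm φ L N) (hh : 0 < h)
    {u : (Fin n → ℝ) → ℂ} (hu : MemLp u 2) :
    Differentiable ℂ fun x => ∫ y, kernel φ h x y * u y := by
  let b : Fin n → (Fin n → ℂ) →L[ℂ] ℂ := fun j =>
    (ContinuousLinearMap.proj j).comp (N.toContinuousLinearEquiv : (Fin n → ℂ) →L[ℂ] Fin n → ℂ)
  let A : (Fin n → ℝ) → (Fin n → ℂ) →L[ℂ] ℂ := fun y => ∑ j, (I / h * (L y j : ℂ)) • b j
  have hLc (j : Fin n) : Continuous fun y => L y j :=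
    (continuous_apply j).comp L.toContinuousLinearEquiv.continuous
  have hA : Continuous A := by
    simp only [A]
    fun_prop
  have hAx (x : Fin n → ℂ) (y : Fin n → ℝ) : A y x = ∑ j, I / h * N x j * L y j := by
    simp only [A, b, sum_apply, smul_apply, smul_eq_mul]
    exact Finset.sum_congr rfl fun j _ => by
      simp only [ContinuousLinearMap.comp_apply, ContinuousLinearMap.proj_apply]
      change _ * N x j = _
      ring
  have hAn (y : Fin n → ℝ) : ‖A y‖ ≤ ∑ j, |L y j| / h * ‖b j‖ := by
    refine (norm_sum_le _ _).trans (Finset.sum_le_sum fun j _ => ?_)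
    rw [norm_smul, norm_mul, norm_div, Complex.norm_I, Complex.norm_real, Complex.norm_real,
      Real.norm_eq_abs, Real.norm_eq_abs, abs_of_pos hh]
    exact le_of_eq (by ring)
  have hG := differentiable_integral_cexp (μ := volume) hA.aestronglyMeasurable
    (v := fun y => kernel φ h 0 y * u y)
    ((continuous_kernel φ h 0).aestronglyMeasurable.mul hu.1) fun R => by
      -- The linear exponent costs half of the Gaussian decay, which turns `h` into `2 h`.
      have hbound : Integrable fun y => Real.exp (∑ j, (|R| * ‖b j‖) ^ 2 / h) *
          ‖kernel φ (2 * h) 0 y * u y‖ :=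
        (integrable_kernel_mul hLN (by positivity) 0 hu).norm.const_mul _
      refine hbound.mono' ((Real.continuous_exp.comp (by fun_prop)).aestronglyMeasurable.mul
        ((continuous_kernel φ h 0).aestronglyMeasurable.mul hu.1).norm)
        (Eventually.of_forall fun y => ?_)
      rw [Real.norm_of_nonneg (by positivity), norm_mul, norm_mul, norm_kernel_zero hLN,
        norm_kernel_zero hLN, ← mul_assoc, ← mul_assoc, ← Real.exp_add, ← Real.exp_add]
      refine mul_le_mul_of_nonneg_right (Real.exp_le_exp.2 ?_) (norm_nonneg _)
      have h1 : R * ‖A y‖ ≤ ∑ j, |R| * (|L y j| / h * ‖b j‖) := by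
        rw [← Finset.mul_sum]
        exact mul_le_mul (le_abs_self R) (hAn y) (norm_nonneg _) (abs_nonneg R)
      have h2 : ∑ j, |R| * (|L y j| / h * ‖b j‖) ≤
          ∑ j, ((|R| * ‖b j‖) ^ 2 / h + 1 / (4 * h) * L y j ^ 2) := by
        refine Finset.sum_le_sum fun j _ => ?_
        have h3 : |R| * (|L y j| / h * ‖b j‖) = (|R| * ‖b j‖ * |L y j|) / h := by ring
        have h4 : (|R| * ‖b j‖) ^ 2 / h + 1 / (4 * h) * L y j ^ 2 =
            ((|R| * ‖b j‖) ^ 2 + 1 / 4 * |L y j| ^ 2) / h := by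
          rw [sq_abs]; field_simp
        rw [h3, h4]
        gcongr
        nlinarith [sq_nonneg (|R| * ‖b j‖ - 1 / 2 * |L y j|)]
      rw [Finset.sum_add_distrib, ← Finset.mul_sum (a := 1 / (4 * h))] at h2
      have h5 : -(1 / (2 * (2 * h))) * ∑ j, L y j ^ 2 =
          -(1 / (2 * h)) * ∑ j, L y j ^ 2 + 1 / (4 * h) * ∑ j, L y j ^ 2 := by
        field_simp; ring
      linarith
  have hp : Differentiable ℂ fun x : Fin n → ℂ => cexp (I * φ (x, 0) / h) := by
    have := differentiable_quadPhase φ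
    fun_prop
  have heq : (fun x => ∫ y, kernel φ h x y * u y) = fun x => cexp (I * φ (x, 0) / h) *
      ∫ y, cexp (A y x) * (kernel φ h 0 y * u y) := by
    ext x
    rw [← integral_const_mul]
    refine integral_congr_ae (Eventually.of_forall fun y => ?_)
    simp only [hAx]
    rw [kernel_eq_mul_kernel_zero hLN h x y]
    ring
  rw [heq]
  exact hp.mul hG

/-- The kernels `k(x, ·)` are total in `L²(ℝⁿ)`: with `x` such that `N x` is real, pairing with
them is a Fourier transform. -/
theorem ae_eq_zero_of_integral_kernel_mul_eq_zero (hLN : IsNormalForm φ L N) (hh : 0 < h)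
    {u : (Fin n → ℝ) → ℂ} (hu : MemLp u 2) (h0 : ∀ x, ∫ y, kernel φ h x y * u y = 0) :
    u =ᵐ[volume] 0 := by
  have hh' : (h : ℂ) ≠ 0 := by exact_mod_cast hh.ne'
  have hint := integrable_kernel_mul hLN hh 0 hu
  have hint' := integrable_comp_linearEquiv L.symm hint
  have hz : (fun t => kernel φ h 0 (L.symm t) * u (L.symm t)) =ᵐ[volume] 0 := by
    refine ae_eq_zero_of_integral_exp_eq_zero hint' fun s => ?_
    let x : Fin n → ℂ := N.symm fun j => h * (s j : ℂ)
    have h1 := h0 x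
    have h2 (y : Fin n → ℝ) : kernel φ h x y * u y = cexp (I * φ (x, 0) / h) *
        (cexp (I * ∑ j, (s j : ℂ) * L y j) * (kernel φ h 0 y * u y)) := by
      rw [kernel_eq_mul_kernel_zero hLN h x y]
      have : ∑ j, I / h * N x j * L y j = I * ∑ j, (s j : ℂ) * L y j := by
        rw [Finset.mul_sum]
        refine Finset.sum_congr rfl fun j _ => ?_
        simp only [x, LinearEquiv.apply_symm_apply]
        field_simp
      rw [this]
      ring
    simp only [h2] at h1
    rw [integral_const_mul, mul_eq_zero, or_iff_right (Complex.exp_ne_zero _)] at h1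
    have h3 := integral_comp_linearEquiv L.symm fun y =>
      cexp (I * ∑ j, (s j : ℂ) * L y j) * (kernel φ h 0 y * u y)
    rw [h1, mul_zero] at h3
    simpa using h3
  have hqmp : Measure.QuasiMeasurePreserving L (volume : Measure (Fin n → ℝ)) volume :=
    Measure.LinearMap.quasiMeasurePreserving volume (L : (Fin n → ℝ) →ₗ[ℝ] Fin n → ℝ) L.isUnit_det'.ne_zero
  have hz' := hqmp.ae_eq_comp hz
  filter_upwards [hz'] with y hy
  simpa [kernel, Complex.exp_ne_zero] using hy

/-! ### Coherent states -/

/-- The coherent state at `a`, that is, the function `y ↦ conj k(a, y)` in `L²(ℝⁿ)`. -/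
noncomputable def coherentState (hLN : IsNormalForm φ L N) (hh : 0 < h) (a : Fin n → ℂ) :
    Lp ℂ 2 (volume : Measure (Fin n → ℝ)) :=
  (memLp_kernel hLN hh a).star.toLp _

theorem inner_coherentState (hLN : IsNormalForm φ L N) (hh : 0 < h) (a : Fin n → ℂ)
    (u : Lp ℂ 2 (volume : Measure (Fin n → ℝ))) :
    ⟪coherentState hLN hh a, u⟫_ℂ = ∫ y, kernel φ h a y * u y := by
  rw [L2.inner_def]
  refine integral_congr_ae ?_
  filter_upwards [(memLp_kernel hLN hh a).star.coeFn_toLp] with y hy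
  rw [coherentState, hy, RCLike.inner_apply]
  simp [mul_comm]

theorem fbi_eq_inner (hLN : IsNormalForm φ L N) (hh : 0 < h) (C : ℝ)
    (u : Lp ℂ 2 (volume : Measure (Fin n → ℝ))) (x : Fin n → ℂ) :
    fbi φ C h u x =
      ((C * h ^ (-(3 * (n : ℝ) / 4)) : ℝ) : ℂ) * ⟪coherentState hLN hh x, u⟫_ℂ := by
  rw [inner_coherentState, fbi]

theorem fbi_zero (hLN : IsNormalForm φ L N) (hh : 0 < h) (C : ℝ) :
    fbi φ C h (0 : Lp ℂ 2 (volume : Measure (Fin n → ℝ))) = 0 := by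
  ext x
  rw [fbi_eq_inner hLN hh, inner_zero_right, mul_zero, Pi.zero_apply]

theorem fbi_add (hLN : IsNormalForm φ L N) (hh : 0 < h) (C : ℝ)
    (u v : Lp ℂ 2 (volume : Measure (Fin n → ℝ))) :
    fbi φ C h (u + v : Lp ℂ 2 (volume : Measure (Fin n → ℝ))) = fbi φ C h u + fbi φ C h v := by
  ext x
  rw [Pi.add_apply, fbi_eq_inner hLN hh, fbi_eq_inner hLN hh, fbi_eq_inner hLN hh,
    inner_add_right, mul_add]

theorem fbi_smul (hLN : IsNormalForm φ L N) (hh : 0 < h) (C : ℝ) (c : ℂ)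
    (u : Lp ℂ 2 (volume : Measure (Fin n → ℝ))) :
    fbi φ C h (c • u : Lp ℂ 2 (volume : Measure (Fin n → ℝ))) = c • fbi φ C h u := by
  ext x
  rw [Pi.smul_apply, fbi_eq_inner hLN hh, fbi_eq_inner hLN hh, inner_smul_right, smul_eq_mul,
    mul_left_comm]

theorem differentiable_fbi (hLN : IsNormalForm φ L N) (hh : 0 < h) (C : ℝ)
    (u : Lp ℂ 2 (volume : Measure (Fin n → ℝ))) : Differentiable ℂ (fbi φ C h u) :=
  (differentiable_integral_kernel_mul hLN hh (Lp.memLp u)).const_mul _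

theorem dense_span_coherentState (hLN : IsNormalForm φ L N) (hh : 0 < h) :
    Dense (Submodule.span ℂ (Set.range (coherentState hLN hh)) :
      Set (Lp ℂ 2 (volume : Measure (Fin n → ℝ)))) := by
  rw [Submodule.dense_iff_topologicalClosure_eq_top, Submodule.topologicalClosure_eq_top_iff,
    Submodule.eq_bot_iff]
  intro u hu
  have h0 (x : Fin n → ℂ) : ∫ y, kernel φ h x y * u y = 0 := by
    rw [← inner_coherentState hLN hh]
    exact Submodule.inner_right_of_mem_orthogonal
      (Submodule.subset_span (Set.mem_range_self x)) hu
  exact (Lp.eq_zero_iff_ae_eq_zero).2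
    (ae_eq_zero_of_integral_kernel_mul_eq_zero hLN hh (Lp.memLp u) h0)

theorem fbi_coherentState (hLN : IsNormalForm φ L N) (hh : 0 < h) (C : ℝ) (a x : Fin n → ℂ) :
    fbi φ C h (coherentState hLN hh a) x =
      ((C * h ^ (-(3 * (n : ℝ) / 4)) * gramConst L h : ℝ) : ℂ) * bergmanExp φ N h a x := by
  rw [fbi_eq_inner hLN hh, inner_coherentState,
    Complex.ofReal_mul _ (gramConst L h), mul_assoc, ← integral_kernel_mul_conj hLN hh]
  congr 1
  refine integral_congr_ae ?_
  filter_upwards [(memLp_kernel hLN hh a).star.coeFn_toLp] with y hy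
  rw [coherentState, hy]
  rfl

/-! ### The weighted space and its reproducing kernel -/

theorem measurable_weight_density (hLN : IsNormalForm φ L N) (h : ℝ) :
    Measurable fun x => ENNReal.ofReal (Real.exp (-2 * weight φ x / h)) := by
  have := (continuous_weight hLN).measurable
  fun_prop

theorem integrable_weightedMeasure_iff (hLN : IsNormalForm φ L N) {f : (Fin n → ℂ) → ℂ} :
    Integrable f (weightedMeasure (weight φ) h) ↔
      Integrable fun x => f x * Real.exp (-2 * weight φ x / h) := by
  rw [weightedMeasure, integrable_withDensity_iff_integrable_smul'
    (measurable_weight_density hLN h) (by simp)]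
  simp [ENNReal.toReal_ofReal (Real.exp_pos _).le, mul_comm]

theorem integral_weightedMeasure (hLN : IsNormalForm φ L N) (f : (Fin n → ℂ) → ℂ) :
    ∫ x, f x ∂weightedMeasure (weight φ) h =
      ∫ x, f x * Real.exp (-2 * weight φ x / h) := by
  rw [weightedMeasure, integral_withDensity_eq_integral_toReal_smul
    (measurable_weight_density hLN h) (by simp)]
  simp [ENNReal.toReal_ofReal (Real.exp_pos _).le, mul_comm]

theorem differentiable_bergmanExp (φ : QuadPhase n) (N : (Fin n → ℂ) ≃ₗ[ℂ] (Fin n → ℂ)) (h : ℝ)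
    (a : Fin n → ℂ) : Differentiable ℂ (bergmanExp φ N h a) := by
  have h1 := differentiable_quadPhase φ
  have h2 (j : Fin n) : Differentiable ℂ fun x => N x j :=
    differentiable_pi.1 N.toContinuousLinearEquiv.differentiable j
  unfold bergmanExp
  fun_prop

theorem memLp_bergmanExp (hLN : IsNormalForm φ L N) (hh : 0 < h) (a : Fin n → ℂ) :
    MemLp (bergmanExp φ N h a) 2 (weightedMeasure (weight φ) h) := by
  have hc := (differentiable_bergmanExp φ N h a).continuous
  rw [memLp_two_iff_integrable_sq_norm hc.aestronglyMeasurable]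
  have h1 : Integrable fun x => ((‖bergmanExp φ N h a x‖ ^ 2 : ℝ) : ℂ) *
      (Real.exp (-2 * weight φ x / h) : ℂ) := by
    simp only [← Complex.ofReal_mul, norm_sq_bergmanExp_mul_exp_weight hLN hh]
    exact (((integrable_gauss N hh).comp_sub_right a).const_mul _).ofReal
  exact ((integrable_weightedMeasure_iff hLN).2 h1).re

/-- The reproducing property of `bergmanExp`: after the translation `x = a + z`, the integrand is
an entire function of `z` times a Gaussian, and the Gaussian is rotation invariant. -/
theorem integral_conj_bergmanExp_mul (hLN : IsNormalForm φ L N) (hh : 0 < h) (a : Fin n → ℂ)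
    {g : (Fin n → ℂ) → ℂ} (hg : Differentiable ℂ g)
    (hg2 : MemLp g 2 (weightedMeasure (weight φ) h)) :
    ∫ x, conj (bergmanExp φ N h a x) * g x ∂weightedMeasure (weight φ) h =
      g a * (∫ z, gauss N h z : ℝ) := by
  have hint : Integrable (fun x => conj (bergmanExp φ N h a x) * g x)
      (weightedMeasure (weight φ) h) := (memLp_bergmanExp hLN hh a).star.integrable_mul hg2
  rw [integrable_weightedMeasure_iff hLN] at hint
  let e : (Fin n → ℂ) → ℂ := fun z => cexp ((I * (φ (a, 0) - φ (a + z, 0)) +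
    1 / 4 * ∑ j, N z j * (2 * N a j + N z j - 2 * conj (N a j))) / h) * g (a + z)
  have he : Differentiable ℂ e := by
    have h1 := differentiable_quadPhase φ
    have h2 (j : Fin n) : Differentiable ℂ fun x => N x j :=
      differentiable_pi.1 N.toContinuousLinearEquiv.differentiable j
    simp only [e]
    fun_prop
  have he0 : e 0 = g a := by simp [e]
  have hterm (z : Fin n → ℂ) : conj (bergmanExp φ N h a (a + z)) * g (a + z) *
      Real.exp (-2 * weight φ (a + z) / h) = e z * gauss N h z := by
    rw [mul_right_comm, conj_bergmanExp_mul_exp_weight hLN hh]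
    simp only [e]
    ring
  rw [integral_weightedMeasure hLN, ← integral_add_left_eq_self _ a]
  simp only [hterm]
  have hint' := hint.comp_add_left a
  simp only [hterm] at hint'
  rw [integral_entire_mul_of_rotation_invariant (w := fun z => (gauss N h z : ℂ)) he
    (Complex.continuous_ofReal.comp (continuous_gauss N h)) (fun θ z => ?_) hint', he0,
    integral_complex_ofReal]
  simp only [gauss, map_smul, Pi.smul_apply, norm_smul, Complex.norm_exp_ofReal_mul_I, one_mul]

/-! ### Unitarity -/

/-- The normalization of the constant that makes the transform isometric. -/
def IsNormalized (L : (Fin n → ℝ) ≃ₗ[ℝ] (Fin n → ℝ)) (N : (Fin n → ℂ) ≃ₗ[ℂ] (Fin n → ℂ))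
    (h C : ℝ) : Prop :=
  (C * h ^ (-(3 * (n : ℝ) / 4))) ^ 2 * gramConst L h * ∫ z, gauss N h z = 1

theorem exists_isNormalized (L : (Fin n → ℝ) ≃ₗ[ℝ] (Fin n → ℝ))
    (N : (Fin n → ℂ) ≃ₗ[ℂ] (Fin n → ℂ)) :
    ∃ C : ℝ, 0 < C ∧ ∀ h : ℝ, 0 < h → IsNormalized L N h C := by
  have hg : 0 < ∫ z, gauss N 1 z := integral_gauss_pos N one_pos
  have hd : 0 < |(LinearMap.det (L : (Fin n → ℝ) →ₗ[ℝ] (Fin n → ℝ)))⁻¹| :=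
    abs_pos.2 (inv_ne_zero L.isUnit_det'.ne_zero)
  have hG : 0 < gramConst L 1 := by
    unfold gramConst; positivity
  refine ⟨(√(gramConst L 1 * ∫ z, gauss N 1 z))⁻¹, by positivity, fun h hh => ?_⟩
  have h1 : gramConst L h = gramConst L 1 * h ^ ((n : ℝ) / 2) := by
    rw [gramConst, gramConst, Real.mul_rpow Real.pi_pos.le hh.le, mul_one, mul_assoc]
  have h2 : (h ^ (-(3 * (n : ℝ) / 4))) ^ 2 * h ^ ((n : ℝ) / 2) * h ^ n = 1 := by
    rw [← Real.rpow_natCast, ← Real.rpow_natCast, ← Real.rpow_mul hh.le, ← Real.rpow_add hh,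
      ← Real.rpow_add hh]
    convert Real.rpow_zero h using 2
    push_cast
    ring
  rw [IsNormalized, h1, integral_gauss_eq N hh, mul_pow, inv_pow, Real.sq_sqrt (by positivity)]
  have h3 : gramConst L 1 * ∫ z, gauss N 1 z ≠ 0 := by positivity
  calc _ = ((gramConst L 1 * ∫ z, gauss N 1 z)⁻¹ * (gramConst L 1 * ∫ z, gauss N 1 z)) *
        ((h ^ (-(3 * (n : ℝ) / 4))) ^ 2 * h ^ ((n : ℝ) / 2) * h ^ n) := by ring
    _ = 1 := by rw [h2, inv_mul_cancel₀ h3, one_mul]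

theorem integral_conj_fbi_coherentState_mul (hLN : IsNormalForm φ L N) (hh : 0 < h)
    (hC : IsNormalized L N h C) (a : Fin n → ℂ) {g : (Fin n → ℂ) → ℂ} (hg : Differentiable ℂ g)
    (hg2 : MemLp g 2 (weightedMeasure (weight φ) h)) :
    ((C * h ^ (-(3 * (n : ℝ) / 4)) : ℝ) : ℂ) *
      ∫ x, conj (fbi φ C h (coherentState hLN hh a) x) * g x ∂weightedMeasure (weight φ) h =
        g a := by
  simp only [fbi_coherentState, map_mul, Complex.conj_ofReal, mul_assoc]
  rw [integral_const_mul, integral_conj_bergmanExp_mul hLN hh a hg hg2]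
  have hC' : (((C * h ^ (-(3 * (n : ℝ) / 4))) ^ 2 * gramConst L h * ∫ z, gauss N h z : ℝ) : ℂ) =
      1 := by rw [hC]; rfl
  push_cast at hC' ⊢
  linear_combination g a * hC'

theorem memLp_fbi_of_mem_span (hLN : IsNormalForm φ L N) (hh : 0 < h) (C : ℝ)
    {u : Lp ℂ 2 (volume : Measure (Fin n → ℝ))}
    (hu : u ∈ Submodule.span ℂ (Set.range (coherentState hLN hh))) :
    MemLp (fbi φ C h u) 2 (weightedMeasure (weight φ) h) := by
  induction hu using Submodule.span_induction with
  | mem u hu =>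
    obtain ⟨a, rfl⟩ := hu
    rw [funext (fbi_coherentState hLN hh C a)]
    exact (memLp_bergmanExp hLN hh a).const_mul _
  | zero =>
    rw [fbi_zero hLN hh]
    exact MemLp.zero
  | add u v _ _ hu hv =>
    rw [fbi_add hLN hh]
    exact hu.add hv
  | smul c u _ hu =>
    rw [fbi_smul hLN hh]
    exact hu.const_smul c

theorem integral_conj_fbi_mul_fbi (hLN : IsNormalForm φ L N) (hh : 0 < h)
    (hC : IsNormalized L N h C) {u v : Lp ℂ 2 (volume : Measure (Fin n → ℝ))}
    (hu : u ∈ Submodule.span ℂ (Set.range (coherentState hLN hh)))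
    (hv : MemLp (fbi φ C h v) 2 (weightedMeasure (weight φ) h)) :
    ∫ x, conj (fbi φ C h u x) * fbi φ C h v x ∂weightedMeasure (weight φ) h = ⟪u, v⟫_ℂ := by
  induction hu using Submodule.span_induction with
  | mem u hu =>
    obtain ⟨a, rfl⟩ := hu
    have h1 := integral_conj_fbi_coherentState_mul hLN hh hC a (differentiable_fbi hLN hh C v) hv
    rw [fbi_eq_inner hLN hh C v a] at h1
    refine mul_left_cancel₀ (fun h0 => ?_) h1
    rw [Complex.ofReal_eq_zero] at h0
    simp [IsNormalized, h0] at hC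
  | zero => simp only [fbi_zero hLN hh, Pi.zero_apply, map_zero, zero_mul, integral_zero,
      inner_zero_left]
  | add u w hu' hw' hu hw =>
    have hi {u} (hu : u ∈ Submodule.span ℂ (Set.range (coherentState hLN hh))) :
        Integrable (fun x => conj (fbi φ C h u x) * fbi φ C h v x)
          (weightedMeasure (weight φ) h) :=
      (memLp_fbi_of_mem_span hLN hh C hu).star.integrable_mul hv
    rw [inner_add_left, ← hu, ← hw, ← integral_add (hi hu') (hi hw')]
    simp only [fbi_add hLN hh, Pi.add_apply, map_add, add_mul]
  | smul c u _ hu =>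
    rw [inner_smul_left, ← hu, ← integral_const_mul]
    congr 1
    ext x
    simp [fbi_smul hLN hh, mul_assoc]

theorem eLpNorm_fbi_of_mem_span (hLN : IsNormalForm φ L N) (hh : 0 < h)
    (hC : IsNormalized L N h C) {u : Lp ℂ 2 (volume : Measure (Fin n → ℝ))}
    (hu : u ∈ Submodule.span ℂ (Set.range (coherentState hLN hh))) :
    eLpNorm (fbi φ C h u) 2 (weightedMeasure (weight φ) h) = ENNReal.ofReal ‖u‖ := by
  have hm := memLp_fbi_of_mem_span hLN hh C hu
  have h1 : ⟪hm.toLp _, hm.toLp _⟫_ℂ = ⟪u, u⟫_ℂ := by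
    rw [← integral_conj_fbi_mul_fbi hLN hh hC hu hm, L2.inner_def]
    refine integral_congr_ae ?_
    filter_upwards [hm.coeFn_toLp] with x hx
    rw [hx, RCLike.inner_apply, mul_comm]
  rw [inner_self_eq_norm_sq_to_K, inner_self_eq_norm_sq_to_K] at h1
  have h2 : ‖hm.toLp _‖ = ‖u‖ :=
    (sq_eq_sq₀ (norm_nonneg _) (norm_nonneg _)).1 (by exact_mod_cast h1)
  rw [← h2, Lp.norm_toLp, ENNReal.ofReal_toReal hm.2.ne]

/-- By density of the coherent states and Fatou's lemma, the transform is bounded on all of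
`L²(ℝⁿ)`. -/
theorem eLpNorm_fbi_le (hLN : IsNormalForm φ L N) (hh : 0 < h) (hC : IsNormalized L N h C)
    (u : Lp ℂ 2 (volume : Measure (Fin n → ℝ))) :
    eLpNorm (fbi φ C h u) 2 (weightedMeasure (weight φ) h) ≤ ENNReal.ofReal ‖u‖ := by
  obtain ⟨v, hv, hvu⟩ := mem_closure_iff_seq_limit.1 (dense_span_coherentState hLN hh u)
  have hlim (x : Fin n → ℂ) :
      Tendsto (fun m => fbi φ C h (v m) x) atTop (𝓝 (fbi φ C h u x)) := by
    simp only [fbi_eq_inner hLN hh]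
    exact (tendsto_const_nhds.inner hvu).const_mul _
  have hFatou := Lp.eLpNorm_lim_le_liminf_eLpNorm (p := 2) (μ := weightedMeasure (weight φ) h)
    (fun m => (differentiable_fbi hLN hh C (v m)).continuous.aestronglyMeasurable)
    (fbi φ C h u) (Eventually.of_forall hlim)
  have hnorm : Tendsto (fun m => ENNReal.ofReal ‖v m‖) atTop (𝓝 (ENNReal.ofReal ‖u‖)) :=
    (ENNReal.continuous_ofReal.tendsto _).comp hvu.norm
  simp only [fun m => eLpNorm_fbi_of_mem_span hLN hh hC (hv m), hnorm.liminf_eq] at hFatou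
  exact hFatou

theorem memLp_fbi (hLN : IsNormalForm φ L N) (hh : 0 < h) (hC : IsNormalized L N h C)
    (u : Lp ℂ 2 (volume : Measure (Fin n → ℝ))) :
    MemLp (fbi φ C h u) 2 (weightedMeasure (weight φ) h) :=
  ⟨(differentiable_fbi hLN hh C u).continuous.aestronglyMeasurable,
    (eLpNorm_fbi_le hLN hh hC u).trans_lt ENNReal.ofReal_lt_top⟩

/-- The FBI transform as a linear map into the weighted `L²` space. -/
noncomputable def fbiLinearMap (hLN : IsNormalForm φ L N) (hh : 0 < h)
    (hC : IsNormalized L N h C) :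
    Lp ℂ 2 (volume : Measure (Fin n → ℝ)) →ₗ[ℂ] Lp ℂ 2 (weightedMeasure (weight φ) h) where
  toFun u := (memLp_fbi hLN hh hC u).toLp _
  map_add' u v := by
    rw [← MemLp.toLp_add]
    simp only [fbi_add hLN hh]
  map_smul' c u := by
    rw [RingHom.id_apply, ← MemLp.toLp_const_smul]
    simp only [fbi_smul hLN hh]

theorem norm_fbiLinearMap (hLN : IsNormalForm φ L N) (hh : 0 < h) (hC : IsNormalized L N h C)
    (u : Lp ℂ 2 (volume : Measure (Fin n → ℝ))) : ‖fbiLinearMap hLN hh hC u‖ = ‖u‖ := by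
  have hle (u : Lp ℂ 2 (volume : Measure (Fin n → ℝ))) : ‖fbiLinearMap hLN hh hC u‖ ≤ 1 * ‖u‖ := by
    rw [one_mul]
    change ‖(memLp_fbi hLN hh hC u).toLp _‖ ≤ _
    rw [Lp.norm_toLp]
    exact ENNReal.toReal_le_of_le_ofReal (norm_nonneg _) (eLpNorm_fbi_le hLN hh hC u)
  have hcont : Continuous (fbiLinearMap hLN hh hC) :=
    ((fbiLinearMap hLN hh hC).mkContinuous 1 hle).continuous
  have hclosed : IsClosed {u | ‖fbiLinearMap hLN hh hC u‖ = ‖u‖} :=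
    isClosed_eq hcont.norm continuous_norm
  refine closure_minimal (fun u hu => ?_) hclosed (dense_span_coherentState hLN hh u)
  change ‖(memLp_fbi hLN hh hC u).toLp _‖ = _
  rw [Lp.norm_toLp, eLpNorm_fbi_of_mem_span hLN hh hC hu, ENNReal.toReal_ofReal (norm_nonneg _)]

/-- The FBI transform as an isometry into the weighted `L²` space. -/
noncomputable def fbiIsometry (hLN : IsNormalForm φ L N) (hh : 0 < h)
    (hC : IsNormalized L N h C) :
    Lp ℂ 2 (volume : Measure (Fin n → ℝ)) →ₗᵢ[ℂ] Lp ℂ 2 (weightedMeasure (weight φ) h) :=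
  ⟨fbiLinearMap hLN hh hC, norm_fbiLinearMap hLN hh hC⟩

theorem fbiIsometry_ae_eq (hLN : IsNormalForm φ L N) (hh : 0 < h) (hC : IsNormalized L N h C)
    (u : Lp ℂ 2 (volume : Measure (Fin n → ℝ))) :
    fbiIsometry hLN hh hC u =ᵐ[weightedMeasure (weight φ) h] fbi φ C h u :=
  (memLp_fbi hLN hh hC u).coeFn_toLp

theorem fbiIsometry_mem_HPhi (hLN : IsNormalForm φ L N) (hh : 0 < h)
    (hC : IsNormalized L N h C) (u : Lp ℂ 2 (volume : Measure (Fin n → ℝ))) :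
    fbiIsometry hLN hh hC u ∈ HPhi (weight φ) h :=
  ⟨_, differentiable_fbi hLN hh C u, fbiIsometry_ae_eq hLN hh hC u⟩

/-- An element of `H_Φ` orthogonal to the transforms of all coherent states vanishes, by the
reproducing property. -/
theorem eq_zero_of_inner_fbi_coherentState_eq_zero (hLN : IsNormalForm φ L N) (hh : 0 < h)
    (hC : IsNormalized L N h C) {F : Lp ℂ 2 (weightedMeasure (weight φ) h)}
    (hF : F ∈ HPhi (weight φ) h)
    (h0 : ∀ a, ⟪fbiIsometry hLN hh hC (coherentState hLN hh a), F⟫_ℂ = 0) : F = 0 := by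
  obtain ⟨g, hg, hFg⟩ := hF
  have hg2 : MemLp g 2 (weightedMeasure (weight φ) h) := (memLp_congr_ae hFg).1 (Lp.memLp F)
  have hg0 (a : Fin n → ℂ) : g a = 0 := by
    rw [← integral_conj_fbi_coherentState_mul hLN hh hC a hg hg2, mul_eq_zero]
    refine Or.inr (Eq.trans ?_ (h0 a))
    rw [L2.inner_def]
    refine integral_congr_ae ?_
    filter_upwards [fbiIsometry_ae_eq hLN hh hC (coherentState hLN hh a), hFg] with x hx hx'
    rw [hx, hx', RCLike.inner_apply, mul_comm]
  rw [Lp.eq_zero_iff_ae_eq_zero]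
  filter_upwards [hFg] with x hx
  rw [hx, hg0 x, Pi.zero_apply]

theorem exists_fbiIsometry_eq (hLN : IsNormalForm φ L N) (hh : 0 < h)
    (hC : IsNormalized L N h C) {F : Lp ℂ 2 (weightedMeasure (weight φ) h)}
    (hF : F ∈ HPhi (weight φ) h) : ∃ u, fbiIsometry hLN hh hC u = F := by
  let T := fbiIsometry hLN hh hC
  let u := ContinuousLinearMap.adjoint T.toContinuousLinearMap F
  refine ⟨u, (sub_eq_zero.1 (eq_zero_of_inner_fbi_coherentState_eq_zero hLN hh hC
    (Submodule.sub_mem _ hF (fbiIsometry_mem_HPhi hLN hh hC u)) fun a => ?_)).symm⟩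
  have h1 : ⟪T (coherentState hLN hh a), F⟫_ℂ = ⟪coherentState hLN hh a, u⟫_ℂ :=
    (ContinuousLinearMap.adjoint_inner_right T.toContinuousLinearMap _ F).symm
  have h2 : ⟪T (coherentState hLN hh a), T u⟫_ℂ = ⟪coherentState hLN hh a, u⟫_ℂ :=
    T.inner_map_map _ _
  rw [inner_sub_right]
  exact sub_eq_zero.2 (h1.trans h2.symm)

/-- The FBI transform as a unitary map onto `H_Φ`. -/
noncomputable def fbiUnitary (hLN : IsNormalForm φ L N) (hh : 0 < h)
    (hC : IsNormalized L N h C) :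
    Lp ℂ 2 (volume : Measure (Fin n → ℝ)) ≃ₗᵢ[ℂ] HPhi (weight φ) h :=
  LinearIsometryEquiv.ofSurjective
    ⟨(fbiIsometry hLN hh hC).toLinearMap.codRestrict (HPhi (weight φ) h)
      (fbiIsometry_mem_HPhi hLN hh hC), fun u => (fbiIsometry hLN hh hC).norm_map u⟩
    fun F => by
      obtain ⟨u, hu⟩ := exists_fbiIsometry_eq hLN hh hC F.2
      exact ⟨u, Subtype.ext hu⟩

end MetaplecticFBI

theorem theorem1p3p3 (n : ℕ) (φ : MetaplecticFBI.QuadPhase n)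
    (hxy : (MetaplecticFBI.hessXY φ).det ≠ 0)
    (hyy : ((MetaplecticFBI.hessYY φ).map Complex.im).PosDef) :
    (∀ x : Fin n → ℂ, BddAbove (Set.range fun y : Fin n → ℝ =>
        -(φ (x, MetaplecticFBI.toComplex y)).im)) ∧
    ∃ C : ℝ, 0 < C ∧ ∀ h : ℝ, 0 < h → h ≤ 1 →
      (∀ u : Lp ℂ 2 (volume : Measure (Fin n → ℝ)),
        (∀ x : Fin n → ℂ, Integrable (fun y : Fin n → ℝ =>
          MetaplecticFBI.kernel φ h x y * u y)) ∧
        Differentiable ℂ (MetaplecticFBI.fbi φ C h u)) ∧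
      ∃ U : Lp ℂ 2 (volume : Measure (Fin n → ℝ)) ≃ₗᵢ[ℂ]
          MetaplecticFBI.HPhi (MetaplecticFBI.weight φ) h,
        ∀ u : Lp ℂ 2 (volume : Measure (Fin n → ℝ)),
          ((U u : Lp ℂ 2 (MetaplecticFBI.weightedMeasure (MetaplecticFBI.weight φ) h)) :
              (Fin n → ℂ) → ℂ)
            =ᵐ[MetaplecticFBI.weightedMeasure (MetaplecticFBI.weight φ) h]
              MetaplecticFBI.fbi φ C h u := by
  obtain ⟨L, N, hLN⟩ := MetaplecticFBI.exists_isNormalForm φ hxy hyy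
  obtain ⟨C, hC0, hC⟩ := MetaplecticFBI.exists_isNormalized L N
  refine ⟨fun x => ⟨_, (MetaplecticFBI.isGreatest_weight hLN x).2⟩, C, hC0, fun h hh _ =>
    ⟨fun u => ⟨fun x => MetaplecticFBI.integrable_kernel_mul hLN hh x (Lp.memLp u),
      MetaplecticFBI.differentiable_fbi hLN hh C u⟩,
      MetaplecticFBI.fbiUnitary hLN hh (hC h hh), fun u =>
        MetaplecticFBI.fbiIsometry_ae_eq hLN hh (hC h hh) u⟩⟩
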